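/- A continuum is a nonempty compact connected metric space. For a continuum $X$ let $2^X$ be the set of nonempty closed subsets of $X$ with the Hausdorff metric $\mathcal H$, and let $C(X)\subset 2^X$ be the set of connected elements (subcontinua). A set $A\in 2^X\setminus\{X\}$ is a shore set if for every $\varepsilon>0$ there is $B\in C(X)$ with $\mathcal H(B,X)<\varepsilon$ and $B\cap A=\emptyset$; a point $p$ is a shore point if $\{p\}$ is a shore set. For $A,B\in 2^X$, $B$ does not block $A$ if there is a continuous $\gamma:[0,1]\to 2^X$ with $\gamma(0)=A$, $\gamma(1)=X$ and $\gamma(t)\cap B=\emptyset$ for all $t<1$. A nonblocker (of singletons) is a set $A\in 2^X\setminus\{X\}$ that does not block $\{x\}$ for any $x\in X\setminus A$; let $\mathcal{CNB}(\mathcal F_1(X))$ be the set of connected nonblockers. For $a\in X$ let $\pi(a)$ be the intersection of all nonblockers containing $a$ if there are any, and $\pi(a)=X$ otherwise, and let $\Lambda_X=\{\pi(a):a\in X\}$. A dendroid is an arcwise connected continuum $X$ that is hereditarily unicoherent, i.e. for every subcontinuum $K$ of $X$ and all subcontinua $P,Q$ with $P\cup Q=K$, the set $P\cap Q$ is connected.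 Theorem. Let $X$ be a dendroid that has a point which is not a shore point. Then $$\Lambda_X=\mathcal{CNB}(\mathcal F_1(X))\cup\{X\}.$$ Equivalently, $\Lambda_X$ equals the set of connected nonblockers if $X$ itself is (vacuously) counted as a nonblocker. -/

import Mathlib

open TopologicalSpace

namespace Continuum

/-- The hyperspace `C(X)` of subcontinua. The hyperspace `2^X` of nonempty closed subsets of a
compact metric space `X` is `NonemptyCompacts X`, whose distance is the Hausdorff metric. -/
def subcontinua (X : Type*) [MetricSpace X] : Set (NonemptyCompacts X) :=
  {A | IsConnected (A : Set X)}

/-- The hyperspace `F₁(X)` of singletons. -/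
def singletons (X : Type*) [MetricSpace X] : Set (NonemptyCompacts X) :=
  Set.range fun x : X => ({x} : NonemptyCompacts X)

/-- A continuum `K` in `X` is unicoherent: whenever it is the union of two subcontinua,
their intersection is connected. -/
def IsUnicoherent {X : Type*} [MetricSpace X] (K : NonemptyCompacts X) : Prop :=
  ∀ A ∈ subcontinua X, ∀ B ∈ subcontinua X, (A : Set X) ∪ B = K →
    IsConnected ((A : Set X) ∩ B)

/-- Any two distinct points are the end points of an arc, that is, of an injective path. -/
def IsArcwiseConnected (X : Type*) [MetricSpace X] : Prop :=
  ∀ x y : X, x ≠ y → ∃ γ : Path x y, Function.Injective γ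

/-- A dendroid: an arcwise connected, hereditarily unicoherent continuum. -/
structure IsDendroid (X : Type*) [MetricSpace X] [CompactSpace X] [ConnectedSpace X] : Prop where
  arcwise : IsArcwiseConnected X
  hereditarilyUnicoherent : ∀ K ∈ subcontinua X, IsUnicoherent K

section Hyperspace

variable (X : Type*) [MetricSpace X] [CompactSpace X] [ConnectedSpace X]

/-- `S(X)`: the shore sets of `X`. Here `⊤` is `X` as an element of `2^X`. -/
def shoreSets : Set (NonemptyCompacts X) :=
  {A | A ≠ ⊤ ∧ ∀ ε : ℝ, 0 < ε → ∃ B ∈ subcontinua X, dist B ⊤ < ε ∧ (B : Set X) ∩ A = ∅}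

/-- `S₁(X) = S(X) ∩ F₁(X)`. -/
def shoreSingletons : Set (NonemptyCompacts X) :=
  shoreSets X ∩ singletons X

variable {X}

/-- `B` blocks `A`: no path in `2^X` from `A` to `X` stays disjoint from `B` before time `1`. -/
def Blocks (B A : NonemptyCompacts X) : Prop :=
  ∀ γ : Path A (⊤ : NonemptyCompacts X), ∃ t : unitInterval, t < 1 ∧ ((γ t : Set X) ∩ B).Nonempty

variable (X)

/-- `NB(F₁(X))`: the proper nonempty closed sets that block no point of their complement. -/
def nonblockers : Set (NonemptyCompacts X) :=
  {A | A ≠ ⊤ ∧ ∀ x : X, x ∉ A → ¬ Blocks A {x}}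

/-- `CNB(F₁(X)) = NB(F₁(X)) ∩ C(X)`. -/
def connectedNonblockers : Set (NonemptyCompacts X) :=
  nonblockers X ∩ subcontinua X

variable {X}

/-- `NB(a, F₁(X))`: the nonblockers containing `a`. -/
def nonblockersAt (a : X) : Set (NonemptyCompacts X) :=
  {A | A ∈ nonblockers X ∧ a ∈ A}

open Classical in
/-- `π(a)`: the intersection of all nonblockers containing `a`, or `X` if there are none. -/
noncomputable def minNonblocker (a : X) : NonemptyCompacts X :=
  if (nonblockersAt a).Nonempty then
    { carrier := ⋂ A ∈ nonblockersAt a, (A : Set X)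
      isCompact' := (isClosed_biInter fun A _ => A.isCompact.isClosed).isCompact
      nonempty' := ⟨a, Set.mem_iInter₂.2 fun _ hA => hA.2⟩ }
  else ⊤

variable (X)

/-- `Λ_X`: the set of all `π(a)`. -/
def minNonblockers : Set (NonemptyCompacts X) :=
  Set.range fun a : X => minNonblocker a

end Hyperspace

end Continuum

open Set Filter Topology Metric

/-! Let `p` be a non-shore point: every continuum close enough to `X` contains `p`. If `A` is a
nonblocker and `x ∉ A`, the stages before time `1` of a path from `{x}` to `X` have connected unions
missing `A` and arbitrarily close to `X`, so one contains `p` and hence the arc from `p` to `x`.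
Thus nonblockers are exactly the nonempty closed sets whose complement is dense and star-shaped
about `p` along arcs (`disjoint_arcHull_of_mem_nonblockers`, `IsDendroid.mem_nonblockers`). This
class is stable under nonempty intersections and under passing to components, so `π(a)`, if not `X`,
is a minimal nonblocker and therefore connected. Conversely, a connected nonblocker is `π(a)` for
its point `a` nearest to `p` along arcs. Finally `π(p) = X`, as no nonblocker contains `p`. -/

namespace Continuum

/-! ### Arcs in dendroids. -/

section Hull

variable {X : Type*} [MetricSpace X]

/-- The intersection of all closed connected sets containing `x` and `y`. In a dendroid it is the
unique arc from `x` to `y`. -/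
def arcHull (x y : X) : Set X :=
  ⋂₀ {K | IsClosed K ∧ IsPreconnected K ∧ x ∈ K ∧ y ∈ K}

theorem arcHull_subset {x y : X} {K : Set X} (hK : IsClosed K) (hc : IsPreconnected K)
    (hx : x ∈ K) (hy : y ∈ K) : arcHull x y ⊆ K :=
  sInter_subset_of_mem ⟨hK, hc, hx, hy⟩

theorem left_mem_arcHull (x y : X) : x ∈ arcHull x y := fun _ hK => hK.2.2.1

theorem right_mem_arcHull (x y : X) : y ∈ arcHull x y := fun _ hK => hK.2.2.2

theorem isClosed_arcHull (x y : X) : IsClosed (arcHull x y) :=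
  isClosed_sInter fun _ hK => hK.1

theorem arcHull_self (x : X) : arcHull x x = {x} :=
  (arcHull_subset isClosed_singleton isPreconnected_singleton rfl rfl).antisymm
    (singleton_subset_iff.2 (left_mem_arcHull x x))

variable [CompactSpace X] [ConnectedSpace X]

theorem IsDendroid.isPreconnected_inter (hX : IsDendroid X) {K L : Set X} (hK : IsClosed K)
    (hL : IsClosed L) (hKc : IsPreconnected K) (hLc : IsPreconnected L) :
    IsPreconnected (K ∩ L) := by
  rcases (K ∩ L).eq_empty_or_nonempty with h | h
  · rw [h]; exact isPreconnected_empty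
  obtain ⟨x, hxK, hxL⟩ := h
  let A : NonemptyCompacts X := ⟨⟨K, hK.isCompact⟩, ⟨x, hxK⟩⟩
  let B : NonemptyCompacts X := ⟨⟨L, hL.isCompact⟩, ⟨x, hxL⟩⟩
  have hA : A ∈ subcontinua X := ⟨⟨x, hxK⟩, hKc⟩
  have hB : B ∈ subcontinua X := ⟨⟨x, hxL⟩, hLc⟩
  have hAB : A ⊔ B ∈ subcontinua X := by
    refine ⟨(A ⊔ B).nonempty, ?_⟩
    rw [NonemptyCompacts.coe_sup]
    exact hKc.union x hxK hxL hLc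
  exact (hX.hereditarilyUnicoherent _ hAB A hA B hB (NonemptyCompacts.coe_sup A B).symm).2

/-- In a dendroid, `arcHull x y` is parametrised by a path, injective unless `x = y`. -/
theorem IsDendroid.exists_path_range_eq (hX : IsDendroid X) (x y : X) :
    ∃ γ : Path x y, range γ = arcHull x y ∧ (x ≠ y → Function.Injective γ) := by
  by_cases hxy : x = y
  · subst hxy
    exact ⟨Path.refl x, by rw [Path.refl_range, arcHull_self], fun h => (h rfl).elim⟩
  obtain ⟨γ, hγ⟩ := hX.arcwise x y hxy
  have hcl : IsClosedEmbedding γ := γ.continuous.isClosedEmbedding hγ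
  refine ⟨γ, Subset.antisymm ?_ ?_, fun _ => hγ⟩
  · refine subset_sInter ?_
    rintro K ⟨hK, hc, hx, hy⟩
    -- Hereditary unicoherence makes `K ∩ range γ` connected, so its parameters form an interval
    -- containing `0` and `1`.
    have h1 : IsPreconnected (γ ⁻¹' K) := by
      rw [← hcl.isInducing.isPreconnected_image, image_preimage_eq_inter_range]
      exact hX.isPreconnected_inter hK hcl.isClosed_range hc (isPreconnected_range γ.continuous)
    have h2 := h1.ordConnected.out (x := 0) (y := 1) (by simpa using hx) (by simpa using hy)
    rintro _ ⟨t, rfl⟩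
    exact h2 ⟨t.2.1, t.2.2⟩
  · exact arcHull_subset hcl.isClosed_range (isPreconnected_range γ.continuous)
      γ.source_mem_range γ.target_mem_range

theorem IsDendroid.isPreconnected_arcHull (hX : IsDendroid X) (x y : X) :
    IsPreconnected (arcHull x y) := by
  obtain ⟨γ, hγ, -⟩ := hX.exists_path_range_eq x y
  rw [← hγ]
  exact isPreconnected_range γ.continuous

/-- If `x` lies on the arc from `p` to `y`, it lies on the arc from `p` to any point between
`x` and `y`. -/
theorem IsDendroid.mem_arcHull_of_mem (hX : IsDendroid X) {p x y z : X} (hx : x ∈ arcHull p y)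
    (hz : z ∈ arcHull x y) : x ∈ arcHull p z := by
  by_cases hpy : p = y
  · subst hpy
    rw [arcHull_self] at hx
    rw [mem_singleton_iff.1 hx]
    exact left_mem_arcHull _ _
  obtain ⟨γ, hγ, hinj⟩ := hX.exists_path_range_eq p y
  have hinj := hinj hpy
  rw [← hγ] at hx
  obtain ⟨s, rfl⟩ := hx
  have himage (t : unitInterval) : IsClosed (γ '' Icc t 1) ∧ IsPreconnected (γ '' Icc t 1) :=
    ⟨(isCompact_Icc.image γ.continuous).isClosed,
      isPreconnected_Icc.image _ γ.continuous.continuousOn⟩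
  have hend (t : unitInterval) : y ∈ γ '' Icc t 1 := ⟨1, ⟨t.2.2, le_rfl⟩, γ.target⟩
  obtain ⟨t, ht, rfl⟩ := arcHull_subset (himage s).1 (himage s).2
    (mem_image_of_mem _ ⟨le_rfl, s.2.2⟩) (hend s) hz
  have hzt : γ t ∈ γ '' Icc t 1 := mem_image_of_mem _ ⟨le_rfl, t.2.2⟩
  -- If `γ s` falls in the tail after `t`, injectivity and `s ≤ t` force `s = t`.
  have hsub : arcHull p y ⊆ arcHull p (γ t) ∪ γ '' Icc t 1 :=
    arcHull_subset ((isClosed_arcHull _ _).union (himage t).1)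
      ((hX.isPreconnected_arcHull _ _).union (γ t) (right_mem_arcHull _ _) hzt (himage t).2)
      (Or.inl (left_mem_arcHull _ _)) (Or.inr (hend t))
  rcases hsub (hγ ▸ mem_range_self s) with h | ⟨r, hr, hrs⟩
  · exact h
  · have : s = t := le_antisymm ht.1 (hinj hrs ▸ hr.1)
    exact this ▸ right_mem_arcHull _ _

/-- A subcontinuum of a dendroid has a point lying on every arc from `p` to the subcontinuum. -/
theorem IsDendroid.exists_forall_mem_arcHull (hX : IsDendroid X) (p : X) {A : Set X}
    (hA : IsClosed A) (hAc : IsConnected A) : ∃ a ∈ A, ∀ y ∈ A, a ∈ arcHull p y := by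
  by_cases hp : p ∈ A
  · exact ⟨p, hp, fun y _ => left_mem_arcHull p y⟩
  obtain ⟨x, hx⟩ := hAc.nonempty
  have hfirst (y : X) (γ : Path p y) (hy : y ∈ A) :
      ∃ t, γ t ∈ A ∧ ∀ s < t, γ s ∉ A := by
    obtain ⟨t, ht⟩ := (hA.preimage γ.continuous).isCompact.exists_isLeast
      ⟨1, by simpa using hy⟩
    exact ⟨t, ht.1, fun s hs h => (ht.2 h).not_gt hs⟩
  obtain ⟨γ, -, -⟩ := hX.exists_path_range_eq p x
  obtain ⟨t, htA, ht⟩ := hfirst x γ hx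
  refine ⟨γ t, htA, fun y hy => ?_⟩
  obtain ⟨δ, hδ, -⟩ := hX.exists_path_range_eq p y
  obtain ⟨t', htA', ht'⟩ := hfirst y δ hy
  have hcl : IsClosed (γ '' Icc 0 t) := (isCompact_Icc.image γ.continuous).isClosed
  have hsub : range δ ⊆ γ '' Icc 0 t ∪ A := by
    rw [hδ]
    exact arcHull_subset (hcl.union hA)
      ((isPreconnected_Icc.image _ γ.continuous.continuousOn).union (γ t)
        (mem_image_of_mem _ ⟨t.2.1, le_rfl⟩) htA hAc.isPreconnected)
      (Or.inl ⟨0, ⟨le_rfl, t.2.1⟩, γ.source⟩) (Or.inr hy)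
  -- Since `t' > 0`, the first hit `δ t'` is a limit of points of `δ` outside `A`, which lie on the
  -- initial segment of `γ`; that segment meets `A` only in `γ t`.
  have hpos : (0 : unitInterval) < t' := by
    refine lt_of_le_of_ne t'.2.1 ?_
    rintro rfl
    exact hp (by simpa using htA')
  have hmem : δ t' ∈ γ '' Icc 0 t := by
    have h1 : t' ∈ closure (Iio t') := by
      rw [closure_Iio' (a := t') ⟨0, hpos⟩]
      exact self_mem_Iic
    have h2 := closure_minimal (t := δ ⁻¹' (γ '' Icc 0 t)) (s := Iio t')
      (fun s hs => (hsub (mem_range_self s)).resolve_right (ht' s hs))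
      (hcl.preimage δ.continuous)
    exact h2 h1
  obtain ⟨r, hr, hrt⟩ := hmem
  have hrt' : r = t := by
    by_contra hne
    exact ht r (lt_of_le_of_ne hr.2 hne) (hrt ▸ htA')
  rw [← hδ, ← hrt', hrt]
  exact mem_range_self t'

end Hull

/-- Infinitely many paths from the same point can be traversed one after the other. -/
theorem exists_ray_through {X : Type*} [MetricSpace X] {x : X} (q : ℕ → X) (α : ∀ n, Path x (q n)) :
    ∃ β : ℝ → X, Continuous β ∧ β 0 = x ∧ (∀ n, q n ∈ β '' Ici 0) ∧
      range β ⊆ ⋃ n, range (α n) := by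
  -- The factor `4u(1 - u)` runs along the path and back, reaching `q n` at `u = 1/2`. Negative `n`
  -- repeat `α 0`.
  let g (n : ℤ) (u : ℝ) : X := (α n.toNat).extend (4 * u * (1 - u))
  have hg (n : ℤ) : Continuous (g n) := by
    exact (α n.toNat).continuous_extend.comp (by fun_prop)
  have hg0 (n : ℤ) : g n 0 = x := by simp [g]
  have hg1 (n : ℤ) : g n 1 = x := by simp [g]
  let β (s : ℝ) : X := g ⌊s⌋ (Int.fract s)
  have heq (n : ℤ) : EqOn (fun s : ℝ => g n (s - n)) β (Icc n (n + 1)) := by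
    rintro s ⟨h1, h2⟩
    rcases h2.eq_or_lt with rfl | h2
    · have : β ((n : ℝ) + 1) = g (n + 1) 0 := by
        have h : ((n : ℝ) + 1) = ((n + 1 : ℤ) : ℝ) := by push_cast; rfl
        simp only [β]
        rw [h, Int.floor_intCast, Int.fract_intCast]
      rw [this, hg0]
      simp only [add_sub_cancel_left, hg1]
    · have : ⌊s⌋ = n := Int.floor_eq_iff.2 ⟨h1, h2⟩
      simp only [β, Int.fract, this]
  refine ⟨β, ?_, ?_, fun n => ⟨n + 1 / 2, ?_, ?_⟩, ?_⟩
  · have hlf : LocallyFinite fun n : ℤ => Icc (n : ℝ) (n + 1) :=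
      locallyFinite_Icc_of_tendsto tendsto_intCast_atTop_atTop
        (tendsto_atBot_add_const_right _ _ (tendsto_intCast_atBot_iff.2 tendsto_id))
    refine hlf.continuous (iUnion_Icc_intCast ℝ) (fun _ => isClosed_Icc) fun n => ?_
    exact (((hg n).comp (by fun_prop : Continuous fun s : ℝ => s - n)).continuousOn).congr
      (heq n).symm
  · simp [β, hg0]
  · simp only [mem_Ici]; positivity
  · have h := heq n (x := (n : ℝ) + 1 / 2) (by simp; norm_num)
    rw [← h]
    simp [g]
    norm_num
  · rintro _ ⟨s, rfl⟩
    refine mem_iUnion.2 ⟨⌊s⌋.toNat, ?_⟩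
    rw [← Path.extend_range]
    exact mem_range_self _

/-! ### Paths in the hyperspace. -/

section Hyperspace

variable {X : Type*} [MetricSpace X] [CompactSpace X]

theorem dist_top_le_dist_top [Nonempty X] {K L : NonemptyCompacts X} (h : (K : Set X) ⊆ L) :
    dist L ⊤ ≤ dist K ⊤ := by
  rw [NonemptyCompacts.dist_eq, NonemptyCompacts.dist_eq]
  refine hausdorffDist_le_of_infDist hausdorffDist_nonneg (fun x _ => ?_) (fun x _ => ?_)
  · rw [infDist_zero_of_mem (by simp)]
    exact hausdorffDist_nonneg
  · refine (infDist_le_infDist_of_subset h K.nonempty).trans ?_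
    rw [hausdorffDist_comm]
    exact infDist_le_hausdorffDist_of_mem (by simp)
      (hausdorffEDist_ne_top_of_nonempty_of_bounded (by simp) K.nonempty
        (isBounded_of_compactSpace) K.isCompact.isBounded)

/-- A dense ray gives rise to a path of continua growing from its origin to the whole space. -/
theorem exists_path_top_of_ray [Nonempty X] {β : ℝ → X} (hβ : Continuous β)
    (hd : Dense (β '' Ici 0)) :
    ∃ γ : Path ({β 0} : NonemptyCompacts X) ⊤, ∀ t, t < 1 → (γ t : Set X) ⊆ range β := by
  let I : NonemptyCompacts ℝ := ⟨⟨Icc 0 1, isCompact_Icc⟩, ⟨0, by simp⟩⟩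
  -- For `s ≥ 0` this is `β '' Icc 0 s`, written over a fixed interval so that continuity in `s` is
  -- immediate.
  let K (s : ℝ) : NonemptyCompacts X := I.map (fun u => β (s * u)) (by fun_prop)
  have hK : Continuous K :=
    Continuous.nonemptyCompacts_map' (f := fun _ : ℝ => I) (g := fun s u => β (s * u))
      continuous_const (by simp only [Function.uncurry_def]; fun_prop)
  have hmem (s r : ℝ) (h0 : 0 ≤ r) (hr : r ≤ s) : β r ∈ (K s : Set X) := by
    rw [NonemptyCompacts.coe_map]
    rcases h0.eq_or_lt with rfl | h0
    · exact ⟨0, ⟨le_rfl, zero_le_one⟩, by simp⟩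
    · have hs : 0 < s := h0.trans_le hr
      exact ⟨r / s, ⟨by positivity, (div_le_one hs).2 hr⟩, by
        simp only; rw [mul_div_cancel₀ _ hs.ne']⟩
  have hlim : Tendsto K atTop (𝓝 ⊤) := by
    rw [Metric.tendsto_atTop]
    intro ε hε
    obtain ⟨T, hT⟩ := isCompact_univ.elim_finite_subcover
      (fun r : Ici (0 : ℝ) => ball (β r) (ε / 2)) (fun _ => isOpen_ball) (by
        intro x _
        obtain ⟨_, ⟨r, hr, rfl⟩, hxr⟩ := hd.exists_dist_lt x (half_pos hε)
        exact mem_iUnion.2 ⟨⟨r, hr⟩, hxr⟩)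
    obtain ⟨N, hN⟩ := (T.finite_toSet.image ((↑) : Ici (0 : ℝ) → ℝ)).bddAbove
    refine ⟨N, fun s hs => lt_of_le_of_lt ?_ (half_lt_self hε)⟩
    rw [NonemptyCompacts.dist_eq]
    refine hausdorffDist_le_of_mem_dist (half_pos hε).le
      (fun x _ => ⟨x, by simp, by simpa using (half_pos hε).le⟩) (fun x _ => ?_)
    obtain ⟨r, hr, hxr⟩ := mem_iUnion₂.1 (hT (mem_univ x))
    exact ⟨β r, hmem s r r.2 ((hN ⟨r, hr, rfl⟩).trans hs), (mem_ball.1 hxr).le⟩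
  have hlim1 : Tendsto (fun t : ℝ => t / (1 - t)) (𝓝[<] 1) atTop := by
    have h1 : Tendsto (fun t : ℝ => (1 - t)⁻¹) (𝓝[<] 1) atTop := by
      refine tendsto_inv_nhdsGT_zero.comp ?_
      refine tendsto_nhdsWithin_iff.2 ⟨?_, ?_⟩
      · have : Tendsto (fun t : ℝ => 1 - t) (𝓝 1) (𝓝 (1 - 1)) := by
          exact (continuous_const.sub continuous_id).tendsto 1
        rw [sub_self] at this
        exact this.mono_left nhdsWithin_le_nhds
      · filter_upwards [self_mem_nhdsWithin] with t ht
        exact sub_pos.2 (mem_Iio.1 ht)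
    have h2 : Tendsto (fun t : ℝ => t) (𝓝[<] 1) (𝓝 1) := nhdsWithin_le_nhds
    exact h2.pos_mul_atTop one_pos h1
  let F (t : ℝ) : NonemptyCompacts X := if t < 1 then K (t / (1 - t)) else ⊤
  have hF : Continuous F := by
    rw [continuous_iff_continuousAt]
    intro t
    rcases lt_trichotomy t 1 with ht | rfl | ht
    · have h1 : ContinuousAt (fun t : ℝ => K (t / (1 - t))) t :=
        hK.continuousAt.comp
          (continuousAt_id.div (continuousAt_const.sub continuousAt_id) (sub_pos.2 ht).ne')
      refine h1.congr ?_
      filter_upwards [Iio_mem_nhds ht] with s hs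
      exact (if_pos hs).symm
    · rw [continuousAt_iff_continuous_left'_right']
      have h1 : F 1 = ⊤ := if_neg (lt_irrefl 1)
      constructor
      · rw [ContinuousWithinAt, h1]
        refine (hlim.comp hlim1).congr' ?_
        filter_upwards [self_mem_nhdsWithin] with s hs
        exact (if_pos hs).symm
      · rw [ContinuousWithinAt, h1]
        refine tendsto_const_nhds.congr' ?_
        filter_upwards [self_mem_nhdsWithin] with s hs
        exact (if_neg (not_lt.2 (le_of_lt hs))).symm
    · refine (continuousAt_const (y := (⊤ : NonemptyCompacts X))).congr ?_
      filter_upwards [Ioi_mem_nhds ht] with s hs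
      exact (if_neg (not_lt.2 (le_of_lt hs))).symm
  refine ⟨⟨⟨fun t => F t, hF.comp continuous_subtype_val⟩, ?_, ?_⟩, fun t ht => ?_⟩
  · have : F 0 = {β 0} := by
      simp only [F, if_pos (zero_lt_one' ℝ), zero_div]
      refine NonemptyCompacts.ext ?_
      simp only [K, NonemptyCompacts.coe_map, zero_mul, NonemptyCompacts.coe_singleton]
      exact I.nonempty.image_const _
    simpa using this
  · simp [F]
  · change (F t : Set X) ⊆ _
    rw [show F t = K (t / (1 - t)) from if_pos ht, NonemptyCompacts.coe_map]
    rintro _ ⟨u, -, rfl⟩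
    exact mem_range_self _

variable [ConnectedSpace X]

/-- If `A` does not block `x`, continua containing `x` and missing `A` approximate the space. -/
theorem exists_subcontinuum_of_not_blocks {A : NonemptyCompacts X} {x : X}
    (h : ¬ Blocks A {x}) {ε : ℝ} (hε : 0 < ε) :
    ∃ B ∈ subcontinua X, x ∈ B ∧ dist B ⊤ < ε ∧ (B : Set X) ∩ A = ∅ := by
  simp only [Blocks, not_forall, not_exists, not_and, not_nonempty_iff_eq_empty] at h
  obtain ⟨γ, hγ⟩ := h
  obtain ⟨t, ht1, ht⟩ : ∃ t : unitInterval, t < 1 ∧ dist (γ t) ⊤ < ε := by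
    have h1 : (1 : unitInterval) ∈ closure (Iio 1) := by
      rw [closure_Iio' (a := (1 : unitInterval)) ⟨0, by simp⟩]
      exact self_mem_Iic
    have h2 : γ ⁻¹' ball ⊤ ε ∈ 𝓝 1 :=
      γ.continuous.continuousAt.preimage_mem_nhds (by rw [γ.target]; exact ball_mem_nhds _ hε)
    obtain ⟨t, ht, ht1⟩ := mem_closure_iff_nhds.1 h1 _ h2
    exact ⟨t, ht1, ht⟩
  let B : NonemptyCompacts X :=
    ⟨⟨⋃ K ∈ γ '' Iic t, (K : Set X), NonemptyCompacts.isCompact_biUnion_coe_of_isCompact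
      (isClosed_Iic.isCompact.image γ.continuous)⟩,
      ⟨x, mem_iUnion₂.2 ⟨γ 0, mem_image_of_mem _ t.2.1, by simp⟩⟩⟩
  have hB : (B : Set X) = ⋃ s ∈ Iic t, (γ s : Set X) := biUnion_image
  refine ⟨B, ⟨B.nonempty, ?_⟩, ?_, ?_, ?_⟩
  · rw [hB]
    let := TopologicalSpace.vietoris X
    -- The union is connected because one stage, `{x}` at time `0`, is.
    refine vietoris.isPreconnected_biUnion isPreconnected_Iic
      (NonemptyCompacts.continuous_coe.comp γ.continuous).continuousOn
      ⟨0, t.2.1, ?_⟩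
    simpa using isPreconnected_singleton
  · rw [← SetLike.mem_coe, hB]
    exact mem_iUnion₂.2 ⟨0, t.2.1, by simp⟩
  · refine (dist_top_le_dist_top ?_).trans_lt ht
    rw [hB]
    exact subset_biUnion_of_mem (u := fun s => (γ s : Set X)) (mem_Iic.2 le_rfl)
  · rw [hB, iUnion₂_inter]
    simp only [iUnion_eq_empty]
    exact fun s hs => hγ s (lt_of_le_of_lt hs ht1)

end Hyperspace

/-! ### Nonblockers seen from a non-shore point. -/

section Dendroid

variable {X : Type*} [MetricSpace X] [CompactSpace X] [ConnectedSpace X]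

theorem dense_compl_of_mem_nonblockers {A : NonemptyCompacts X} (hA : A ∈ nonblockers X) :
    Dense (A : Set X)ᶜ := by
  obtain ⟨x, hx⟩ : ∃ x, x ∉ A := by
    by_contra! h
    exact hA.1 (NonemptyCompacts.ext (by ext x; simpa using h x))
  rw [Metric.dense_iff]
  intro y r hr
  obtain ⟨B, -, -, hB, hBA⟩ := exists_subcontinuum_of_not_blocks (hA.2 x hx) hr
  rw [NonemptyCompacts.dist_eq] at hB
  obtain ⟨b, hb, hby⟩ := exists_dist_lt_of_hausdorffDist_lt' (y := y) (by simp) hB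
    (hausdorffEDist_ne_top_of_nonempty_of_bounded B.nonempty (by simp)
        B.isCompact.isBounded (isBounded_of_compactSpace))
  exact ⟨b, hby, fun hbA => (hBA ▸ ⟨hb, hbA⟩ : b ∈ (∅ : Set X))⟩

variable {p : X}

theorem disjoint_arcHull_of_mem_nonblockers
    (hp : ({p} : NonemptyCompacts X) ∉ shoreSingletons X) {A : NonemptyCompacts X}
    (hA : A ∈ nonblockers X) {x : X} (hx : x ∉ A) : Disjoint (arcHull p x) A := by
  have hne : ({p} : NonemptyCompacts X) ≠ ⊤ := by
    intro h
    have hall (y : X) : y = p := by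
      have hy : y ∈ (⊤ : NonemptyCompacts X) := mem_univ y
      rw [← h] at hy
      simpa using hy
    obtain ⟨a, ha⟩ := A.nonempty
    rw [hall x, ← hall a] at hx
    exact hx ha
  obtain ⟨ε, hε, h⟩ : ∃ ε : ℝ, 0 < ε ∧
      ∀ B ∈ subcontinua X, dist B ⊤ < ε → p ∈ B := by
    by_contra! hcon
    refine hp ⟨⟨hne, fun ε hε => ?_⟩, p, rfl⟩
    obtain ⟨B, hB, hBε, hpB⟩ := hcon ε hε
    exact ⟨B, hB, hBε, by simpa using hpB⟩
  obtain ⟨B, hB, hxB, hBε, hBA⟩ := exists_subcontinuum_of_not_blocks (hA.2 x hx) hε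
  exact (disjoint_iff_inter_eq_empty.2 hBA).mono_left
    (arcHull_subset B.isCompact.isClosed hB.2 (h B hB hBε) hxB)

/-- From `x`, run through `p` to each point of a dense sequence of the complement and back; the
resulting dense ray misses `A`. Here `p` may be any point. -/
theorem IsDendroid.mem_nonblockers (hX : IsDendroid X) {A : NonemptyCompacts X}
    (hd : Dense (A : Set X)ᶜ) (hA : ∀ x ∉ A, Disjoint (arcHull p x) A) : A ∈ nonblockers X := by
  refine ⟨?_, fun x hx => ?_⟩
  · rintro rfl
    simpa using hd.nonempty
  have : Nonempty ((A : Set X)ᶜ : Set X) := ⟨⟨x, hx⟩⟩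
  obtain ⟨u, hu⟩ := exists_dense_seq ((A : Set X)ᶜ : Set X)
  have hpath (n : ℕ) : ∃ α : Path x (u n : X), range α ⊆ (A : Set X)ᶜ := by
    obtain ⟨γ, hγ, -⟩ := hX.exists_path_range_eq p x
    obtain ⟨δ, hδ, -⟩ := hX.exists_path_range_eq p (u n)
    refine ⟨γ.symm.trans δ, ?_⟩
    rw [Path.trans_range, Path.symm_range, hγ, hδ]
    exact union_subset (hA x hx).subset_compl_right (hA _ (u n).2).subset_compl_right
  choose α hα using hpath
  obtain ⟨β, hβ, rfl, hβu, hβα⟩ := exists_ray_through _ α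
  have hdense : Dense (β '' Ici 0) := by
    have h1 : Dense (range fun n => (u n : X)) :=
      hd.denseRange_val.comp hu continuous_subtype_val
    exact h1.mono (range_subset_iff.2 hβu)
  obtain ⟨γ, hγ⟩ := exists_path_top_of_ray hβ hdense
  intro hblock
  obtain ⟨t, ht, y, hyt, hyA⟩ := hblock γ
  exact (hβα.trans (iUnion_subset hα)) (hγ t ht hyt) hyA

theorem minNonblocker_eq_top {a : X} (h : ¬ (nonblockersAt a).Nonempty) :
    minNonblocker a = ⊤ := if_neg h

theorem coe_minNonblocker {a : X} (h : (nonblockersAt a).Nonempty) :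
    (minNonblocker a : Set X) = ⋂ A ∈ nonblockersAt a, (A : Set X) := by
  rw [minNonblocker, if_pos h]
  rfl

theorem mem_minNonblocker (a : X) : a ∈ (minNonblocker a : Set X) := by
  by_cases h : (nonblockersAt a).Nonempty
  · rw [coe_minNonblocker h]
    exact mem_iInter₂.2 fun _ hA => hA.2
  · rw [minNonblocker_eq_top h]; simp

theorem minNonblocker_subset {a : X} {A : NonemptyCompacts X} (hA : A ∈ nonblockers X)
    (ha : a ∈ A) : (minNonblocker a : Set X) ⊆ A := by
  have hmem : A ∈ nonblockersAt a := ⟨hA, ha⟩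
  rw [coe_minNonblocker ⟨A, hmem⟩]
  exact biInter_subset_of_mem hmem

theorem IsDendroid.minNonblocker_mem_nonblockers (hX : IsDendroid X)
    (hp : ({p} : NonemptyCompacts X) ∉ shoreSingletons X) {a : X}
    (h : (nonblockersAt a).Nonempty) : minNonblocker a ∈ nonblockers X := by
  refine hX.mem_nonblockers (p := p) ?_ fun x hx => ?_
  · obtain ⟨A, hA, ha⟩ := h
    exact (dense_compl_of_mem_nonblockers hA).mono
      (compl_subset_compl.2 (minNonblocker_subset hA ha))
  · rw [← SetLike.mem_coe, coe_minNonblocker h] at hx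
    simp only [mem_iInter, not_forall] at hx
    obtain ⟨A, hA, hxA⟩ := hx
    exact (disjoint_arcHull_of_mem_nonblockers hp hA.1 hxA).mono_right
      (minNonblocker_subset hA.1 hA.2)

/-- The component of `a` in `π(a)` is again a nonblocker, so by minimality it is all of `π(a)`. -/
theorem IsDendroid.minNonblocker_mem_connectedNonblockers (hX : IsDendroid X)
    (hp : ({p} : NonemptyCompacts X) ∉ shoreSingletons X) {a : X}
    (h : (nonblockersAt a).Nonempty) : minNonblocker a ∈ connectedNonblockers X := by
  have hM := hX.minNonblocker_mem_nonblockers hp h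
  refine ⟨hM, (minNonblocker a).nonempty, ?_⟩
  set M : Set X := (minNonblocker a : Set X)
  have hMcl : IsClosed M := (minNonblocker a).isCompact.isClosed
  have haM : a ∈ M := mem_minNonblocker a
  have haC : a ∈ connectedComponentIn M a := mem_connectedComponentIn haM
  have hC : IsClosed (connectedComponentIn M a) := by
    refine isClosed_of_closure_subset (IsPreconnected.subset_connectedComponentIn
      isPreconnected_connectedComponentIn.closure (subset_closure haC) ?_)
    exact closure_minimal (connectedComponentIn_subset M a) hMcl
  let C : NonemptyCompacts X := ⟨⟨connectedComponentIn M a, hC.isCompact⟩, ⟨a, haC⟩⟩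
  have hCM : (C : Set X) ⊆ M := connectedComponentIn_subset M a
  have hCN : C ∈ nonblockers X := by
    refine hX.mem_nonblockers (p := p)
      ((dense_compl_of_mem_nonblockers hM).mono (compl_subset_compl.2 hCM)) fun x hx => ?_
    rw [disjoint_left]
    intro z hzx hzC
    -- A point `w ∉ M` between `z` and `x` would have its arc from `p` pass through `z ∈ M`.
    have hsub : arcHull z x ⊆ M := by
      intro w hw
      by_contra hwM
      exact (disjoint_left.1 (disjoint_arcHull_of_mem_nonblockers hp hM hwM))
        (hX.mem_arcHull_of_mem hzx hw) (hCM hzC)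
    have h1 : connectedComponentIn M a = connectedComponentIn M z := connectedComponentIn_eq hzC
    refine hx (?_ : x ∈ connectedComponentIn M a)
    rw [h1]
    exact (hX.isPreconnected_arcHull z x).subset_connectedComponentIn (left_mem_arcHull z x) hsub
      (right_mem_arcHull z x)
  have hMC : M = connectedComponentIn M a :=
    (minNonblocker_subset hCN haC).antisymm (connectedComponentIn_subset M a)
  rw [hMC]
  exact isPreconnected_connectedComponentIn

/-- Take `a ∈ A` on every arc from `p` to `A`: a point of `A` outside `π(a)` would have its arc from
`p` miss `a`. -/
theorem IsDendroid.exists_minNonblocker_eq (hX : IsDendroid X)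
    (hp : ({p} : NonemptyCompacts X) ∉ shoreSingletons X) {A : NonemptyCompacts X}
    (hA : A ∈ connectedNonblockers X) : ∃ a, minNonblocker a = A := by
  obtain ⟨a, ha, haA⟩ := hX.exists_forall_mem_arcHull p A.isCompact.isClosed hA.2
  refine ⟨a, NonemptyCompacts.ext ((minNonblocker_subset hA.1 ha).antisymm fun y hy => ?_)⟩
  by_contra hyM
  exact disjoint_left.1 (disjoint_arcHull_of_mem_nonblockers hp
    (hX.minNonblocker_mem_nonblockers hp ⟨A, hA.1, ha⟩) hyM) (haA y hy) (mem_minNonblocker a)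

theorem not_nonempty_nonblockersAt (hp : ({p} : NonemptyCompacts X) ∉ shoreSingletons X) :
    ¬ (nonblockersAt p).Nonempty := by
  rintro ⟨A, hA, hpA⟩
  obtain ⟨x, hx⟩ := (dense_compl_of_mem_nonblockers hA).nonempty
  exact disjoint_left.1 (disjoint_arcHull_of_mem_nonblockers hp hA hx) (left_mem_arcHull p x) hpA

end Dendroid

end Continuum

theorem mainTheorem9 (X : Type*) [MetricSpace X] [CompactSpace X] [ConnectedSpace X]
    (hX : Continuum.IsDendroid X)
    (hS : ∃ p : X, ({p} : TopologicalSpace.NonemptyCompacts X) ∉ Continuum.shoreSingletons X) :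
    Continuum.minNonblockers X = insert ⊤ (Continuum.connectedNonblockers X) := by
  obtain ⟨p, hp⟩ := hS
  refine Set.Subset.antisymm ?_ (Set.insert_subset ?_ ?_)
  · rintro _ ⟨a, rfl⟩
    by_cases h : (Continuum.nonblockersAt a).Nonempty
    · exact Or.inr (hX.minNonblocker_mem_connectedNonblockers hp h)
    · exact Or.inl (Continuum.minNonblocker_eq_top h)
  · exact ⟨p, Continuum.minNonblocker_eq_top (Continuum.not_nonempty_nonblockersAt hp)⟩
  · exact fun A hA => hX.exists_minNonblocker_eq hp hA
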